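/- All graphs are finite and simple. Let $\Gamma=(V,E)$ be a graph with adjacency matrix $A$ and set of arcs $\mathcal A=\{(x,y),(y,x) : \{x,y\}\in E\}$. For an arc $a=(x,y)$ put $t(a)=y$ and $a^{-1}=(y,x)$. Define $d\in\mathbb C^{V\times\mathcal A}$ by $d_{x,a}=\frac{1}{\sqrt{\deg x}}\,\delta_{x,t(a)}$ and $R\in\mathbb C^{\mathcal A\times\mathcal A}$ by $R_{a,b}=\delta_{a,b^{-1}}$. The Grover walk on $\Gamma$ is the quantum walk with time evolution matrix $U=R(2d^*d-I)$. A state is a vector $\Phi\in\mathbb C^{\mathcal A}$ with $\|\Phi\|=1$; it is of vertex type if $\Phi=d^*e_x$ for some $x\in V$, where $e_x$ is the standard unit vector. The graph $\Gamma$ admits perfect state transfer if there are two distinct vertex type states $\Phi,\Psi$, an integer $\tau\ge 1$ and a $\gamma\in\mathbb C$ with $|\gamma|=1$ such that $U^\tau\Phi=\gamma\Psi$. For an integer $\ell\ge 2$, $\Gamma$ is strongly $\ell$-walk-regular if $A^\ell$ is a linear combination of $I$, $A$ and the all-ones matrix $J$. It is a genuine strongly walk-regular graph if it is connected, is strongly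 $\ell$-walk-regular for some $\ell\ge2$, and $A$ has exactly four distinct eigenvalues. **Corollary.** Let $\Gamma$ be a genuine strongly walk-regular graph with distinct eigenvalues $k>\theta_1>\theta_2>\theta_3$. If $\Gamma$ admits perfect state transfer, then $\Gamma$ is regular of valency $k$ and $$(\theta_1,\theta_2,\theta_3)=\left(\tfrac k2,\,0,\,-\tfrac k2\right).$$ Consequently the spectrum of $\Gamma$ (the multiset of eigenvalues of $A$) is $\{[k]^1,[\tfrac k2]^{\alpha},[0]^{\beta},[-\tfrac k2]^{\gamma}\}$ for some positive integers $\alpha,\beta,\gamma$, where exponents denote multiplicities. -/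

import Mathlib

open scoped Matrix

namespace GroverWalk

variable {V : Type*} [Fintype V] [DecidableEq V] (G : SimpleGraph V) [DecidableRel G.Adj]

/-- The boundary matrix `d`, with `d x a = 1 / √(deg x)` if the arc `a` has terminus `x`, and `0`
otherwise. The symmetric arcs of `G` are its darts, with origin `a.fst` and terminus `a.snd`. -/
noncomputable def boundaryMatrix : Matrix V G.Dart ℂ :=
  Matrix.of fun x a => if x = a.snd then ((1 / Real.sqrt (G.degree x) : ℝ) : ℂ) else 0

/-- The shift matrix `R`, with `R a b = 1` if `a` is the inverse arc of `b`, and `0` otherwise. -/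
def shiftMatrix : Matrix G.Dart G.Dart ℂ :=
  Matrix.of fun a b => if a = b.symm then 1 else 0

/-- The time evolution matrix `U = R (2 d* d - I)` of the Grover walk on `G`. -/
noncomputable def evolutionMatrix : Matrix G.Dart G.Dart ℂ :=
  shiftMatrix G * ((2 : ℂ) • ((boundaryMatrix G)ᴴ * boundaryMatrix G) - 1)

/-- A state is a vector of Euclidean norm one, indexed by the arcs. -/
def IsState (Φ : G.Dart → ℂ) : Prop :=
  ‖WithLp.toLp 2 Φ‖ = 1

/-- A state is of vertex type if it equals `d* e_x` for some vertex `x`. -/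
def IsVertexTypeState (Φ : G.Dart → ℂ) : Prop :=
  IsState G Φ ∧ ∃ x : V, Φ = (boundaryMatrix G)ᴴ *ᵥ Pi.single x 1

/-- Perfect state transfer from the state `Φ` to the distinct state `Ψ` at time `τ ≥ 1`. -/
def PerfectStateTransfer (Φ Ψ : G.Dart → ℂ) (τ : ℕ) : Prop :=
  IsState G Φ ∧ IsState G Ψ ∧ Φ ≠ Ψ ∧ 1 ≤ τ ∧
    ∃ γ : ℂ, ‖γ‖ = 1 ∧ (evolutionMatrix G ^ τ) *ᵥ Φ = γ • Ψ

/-- `G` admits perfect state transfer: it occurs, at some time, between two distinct vertex type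
states. -/
def AdmitsPerfectStateTransfer : Prop :=
  ∃ Φ Ψ : G.Dart → ℂ, IsVertexTypeState G Φ ∧ IsVertexTypeState G Ψ ∧
    ∃ τ : ℕ, PerfectStateTransfer G Φ Ψ τ

/-- The spectrum of `G`: the multiset of eigenvalues of its adjacency matrix, which is real
symmetric, so that all of them are real. -/
noncomputable def graphSpectrum : Multiset ℝ :=
  (G.adjMatrix ℝ).charpoly.roots

/-- The set of distinct eigenvalues of `G`. -/
noncomputable def distinctEigenvalues : Finset ℝ :=
  (graphSpectrum G).toFinset

/-- `G` is strongly `ℓ`-walk-regular: `ℓ ≥ 2`, and `A ^ ℓ` is a linear combination of `I`, `A` and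
the all-ones matrix `J`. -/
def IsStronglyWalkRegular (ℓ : ℕ) : Prop :=
  2 ≤ ℓ ∧ ∃ a b c : ℝ, G.adjMatrix ℝ ^ ℓ =
    a • (1 : Matrix V V ℝ) + b • G.adjMatrix ℝ + c • (Matrix.of fun _ _ => 1)

/-- `G` is a genuine strongly walk-regular graph: connected, strongly `ℓ`-walk-regular for some
`ℓ ≥ 2`, with exactly four distinct eigenvalues. -/
def IsGenuineStronglyWalkRegular : Prop :=
  G.Connected ∧ (∃ ℓ : ℕ, IsStronglyWalkRegular G ℓ) ∧ (distinctEigenvalues G).card = 4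

end GroverWalk

/-! Write `A ^ n = a I + b A + c J`. The trinomial `X ^ n - b X - a` has at most three real roots,
so four eigenvalues force `c ≠ 0`. Then `J` is a polynomial in `A`, so the graph is regular, of
valency `k`, and `θ₁, θ₂, θ₃` are roots of the trinomial. Four eigenvalues also make the graph
walk-regular: every polynomial in `A` has constant diagonal (`aeval_adjMatrix_diag_eq`).

On vertex type states the walk acts through Chebyshev polynomials: `d U^τ d* = T_τ(A/k)`
(`boundaryMatrix_mul_evolutionMatrix_pow`). Perfect state transfer gives `T_τ(A/k)²` a diagonal
entry 1. Its diagonal is then constantly 1, and since `|T_τ| ≤ 1` on `[-1, 1]`, taking the trace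
gives `T_τ(θ/k) = ±1` for each eigenvalue. So `2θ/k` is twice the cosine of a rational multiple of
`π`, an algebraic integer.

The numbers `x, y, z = 2θᵢ/k` lie in `[-2, 2)`, and their elementary symmetric functions are
rational and integral, hence integers. Being also roots of a trinomial, they sum to zero
(`sum_eq_zero_of_pow_eq_affine`). Only finitely many integral cubics remain, and the traces of `A`
and `A²` exclude all but `X³ - X` (`eq_one_zero_neg_one`). -/

/-! ### Real roots of trinomials -/

/-- No three distinct nonnegative reals lie on a common line of the graph of `x ↦ x ^ n`. -/
lemma not_three_pow_eq_affine_of_nonneg {n : ℕ} (hn : 2 ≤ n) {a b x y z : ℝ}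
    (hx : 0 ≤ x) (hxy : x < y) (hyz : y < z)
    (ex : x ^ n = b * x + a) (ey : y ^ n = b * y + a) (ez : z ^ n = b * z + a) : False := by
  have h := (strictConvexOn_pow hn).slope_strict_mono_adjacent (Set.mem_Ici.2 hx)
    (Set.mem_Ici.2 (by linarith : (0 : ℝ) ≤ z)) hxy hyz
  simp only [ex, ey, ez] at h
  rw [show b * y + a - (b * x + a) = b * (y - x) by ring,
    show b * z + a - (b * y + a) = b * (z - y) by ring,
    mul_div_cancel_right₀ _ (by linarith), mul_div_cancel_right₀ _ (by linarith)] at h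
  exact lt_irrefl _ h

lemma not_three_pow_eq_affine_of_even {n : ℕ} (hn : 2 ≤ n) (he : Even n) {a b x y z : ℝ}
    (hxy : x < y) (hyz : y < z)
    (ex : x ^ n = b * x + a) (ey : y ^ n = b * y + a) (ez : z ^ n = b * z + a) : False := by
  have h := (he.strictConvexOn_pow (by omega)).slope_strict_mono_adjacent (Set.mem_univ x)
    (Set.mem_univ z) hxy hyz
  simp only [ex, ey, ez] at h
  rw [show b * y + a - (b * x + a) = b * (y - x) by ring,
    show b * z + a - (b * y + a) = b * (z - y) by ring,
    mul_div_cancel_right₀ _ (by linarith), mul_div_cancel_right₀ _ (by linarith)] at h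
  exact lt_irrefl _ h

/-- The alternant of `1`, `x`, `x ^ n` at three points of which one is positive and two are negative
is positive if the sum of the points is. -/
lemma alternant_pos {x y z : ℝ} (hx : 0 < x) (hy : y < 0) (hzy : z < y) (hs : 0 < x + y + z)
    (n : ℕ) : 0 < x ^ (n + 2) * (y - z) + y ^ (n + 2) * (z - x) + z ^ (n + 2) * (x - y) := by
  set D : ℕ → ℝ := fun n => x ^ n * (y - z) + y ^ n * (z - x) + z ^ n * (x - y) with hD
  -- The three points are the roots of a monic cubic, which gives a linear recurrence. Under the
  -- sign hypotheses all its coefficients are positive.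
  have hrec (n) : D (n + 3) = (x + y + z) * D (n + 2) + -(x * y + y * z + z * x) * D (n + 1)
      + x * y * z * D n := by
    simp only [hD]; ring
  have h2 : 0 < -(x * y + y * z + z * x) := by nlinarith [mul_pos_of_neg_of_neg hy (hzy.trans hy)]
  have h3 : 0 < x * y * z := mul_pos_of_neg_of_neg (mul_neg_of_pos_of_neg hx hy) (hzy.trans hy)
  have d0 : D 0 = 0 := by simp only [hD]; ring
  have d1 : D 1 = 0 := by simp only [hD]; ring
  have d2 : 0 < D 2 := by
    have : D 2 = (x - y) * (x - z) * (y - z) := by simp only [hD]; ring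
    rw [this]
    exact mul_pos (mul_pos (by linarith) (by linarith)) (by linarith)
  have key (n) : 0 ≤ D n ∧ 0 ≤ D (n + 1) ∧ 0 < D (n + 2) := by
    induction n with
    | zero => exact ⟨d0.ge, d1.ge, d2⟩
    | succ n ih =>
      obtain ⟨i0, i1, i2⟩ := ih
      refine ⟨i1, i2.le, ?_⟩
      rw [show n + 1 + 2 = n + 3 from rfl, hrec]
      have := mul_pos hs i2
      have := mul_nonneg h2.le i1
      have := mul_nonneg h3.le i0
      linarith
  exact (key n).2.2

/-- Convexity and the sign of the product force `z < y < 0 < x`. A positive sum contradicts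
`alternant_pos`, since the alternant vanishes on a line. A negative sum is excluded by integrality:
the cubic at `-1` would take a value strictly between two consecutive integers. -/
lemma sum_eq_zero_of_pow_eq_affine_of_prod_pos {n : ℕ} (hn : 2 ≤ n) (ho : Odd n)
    {a b x y z : ℝ} (hyx : y < x) (hzy : z < y) (hx2 : x ≤ 2) (hz2 : -2 ≤ z)
    (ex : x ^ n = b * x + a) (ey : y ^ n = b * y + a) (ez : z ^ n = b * z + a)
    {s t p : ℤ} (hs : x + y + z = s) (ht : x * y + y * z + z * x = t) (hp : x * y * z = p)
    (hpos : 0 < x * y * z) : x + y + z = 0 := by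
  rcases lt_or_ge 0 z with hz | hz
  · exact (not_three_pow_eq_affine_of_nonneg hn hz.le hzy hyx ez ey ex).elim
  have hz : z < 0 := lt_of_le_of_ne hz (by rintro rfl; simp at hpos)
  have hxy : x * y < 0 := by
    by_contra! h
    nlinarith
  have hy : y < 0 := by
    by_contra! h
    nlinarith [mul_nonneg (h.trans hyx.le) h]
  have hx : 0 < x := by
    by_contra! h
    nlinarith [mul_nonneg_of_nonpos_of_nonpos h hy.le]
  rcases lt_trichotomy (x + y + z) 0 with h | h | h
  · exfalso
    obtain ⟨m, rfl⟩ : ∃ m, n = m + 1 := ⟨n - 1, by omega⟩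
    have hm : m ≠ 0 := by omega
    have hme : Even m := by
      rw [Nat.odd_add_one, Nat.not_odd_iff_even] at ho
      exact ho
    have hyz : y ^ m < z ^ m := by
      rw [← hme.neg_pow y, ← hme.neg_pow z]
      exact pow_lt_pow_left₀ (by linarith) (by linarith) hm
    rw [pow_succ] at ex ey ez
    have ha : 0 < a := by
      have : y * z * (z ^ m - y ^ m) = a * (y - z) := by linear_combination y * ez - z * ey
      have h1 : 0 < y * z * (z ^ m - y ^ m) :=
        mul_pos (mul_pos_of_neg_of_neg hy hz) (by linarith)
      rw [this] at h1
      exact pos_of_mul_pos_left h1 (by linarith)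
    have hxz : -z < x := by
      by_contra! hle
      have h1 : x ^ m ≤ z ^ m := by
        rw [← hme.neg_pow z]
        exact pow_le_pow_left₀ hx.le hle m
      have : -z * x * (x ^ m - z ^ m) = a * (x - z) := by linear_combination -z * ex + x * ez
      have h2 : -z * x * (x ^ m - z ^ m) ≤ 0 :=
        mul_nonpos_of_nonneg_of_nonpos (mul_nonneg (by linarith) hx.le) (by linarith)
      have h3 : 0 < a * (x - z) := mul_pos ha (by linarith)
      linarith
    -- Since `x + z > 0`, the sum exceeds `y > z ≥ -2`.
    have hs1 : s = -1 := by
      have h1 : (s : ℝ) < 0 := by linarith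
      have h2 : (-2 : ℝ) < s := by linarith
      have h1 : s < 0 := by exact_mod_cast h1
      have h2 : -2 < s := by exact_mod_cast h2
      omega
    subst hs1
    push_cast at hs
    have hN : (1 + x) * (1 + y) * (1 + z) = ((t + p : ℤ) : ℝ) := by
      push_cast
      linear_combination hs + ht + hp
    have hy1 : 0 < -1 - y := by linarith
    have hz1 : 0 < -1 - z := by linarith
    have hNpos : 0 < (1 + x) * (1 + y) * (1 + z) := by
      have := mul_pos (mul_pos (by linarith : 0 < 1 + x) hy1) hz1
      linarith
    rw [hN] at hNpos
    have h1 : (1 : ℝ) ≤ ((t + p : ℤ) : ℝ) := by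
      exact_mod_cast (Int.cast_pos.1 hNpos : 0 < t + p)
    rw [← hN] at h1
    -- The two positive factors add up to `x - 1 ≤ 1`. With `1 + x ≤ 3` the product in `h1` is at
    -- most `3/4`.
    have hq : (-1 - y) * (-1 - z) ≤ 1 / 4 := by nlinarith [sq_nonneg (y - z)]
    nlinarith [mul_pos hy1 hz1]
  · exact h
  · obtain ⟨m, rfl⟩ : ∃ m, n = m + 2 := ⟨n - 2, by omega⟩
    have h1 := alternant_pos hx hy hzy h m
    rw [ex, ey, ez] at h1
    ring_nf at h1
    exact (lt_irrefl _ h1).elim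

lemma add_eq_zero_of_pow_eq_mul {n : ℕ} (ho : Odd n) {b x y : ℝ} (hx : x ≠ 0) (hy : y ≠ 0)
    (hxy : x ≠ y) (ex : x ^ n = b * x) (ey : y ^ n = b * y) (hn : 2 ≤ n) : x + y = 0 := by
  obtain ⟨m, rfl⟩ : ∃ m, n = m + 1 := ⟨n - 1, by omega⟩
  have hme : Even m := by
    rw [Nat.odd_add_one, Nat.not_odd_iff_even] at ho
    exact ho
  rw [pow_succ] at ex ey
  have h : |x| ^ m = |y| ^ m := by
    rw [hme.pow_abs, hme.pow_abs, mul_right_cancel₀ hx ex, mul_right_cancel₀ hy ey]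
  have h := (pow_left_inj₀ (abs_nonneg x) (abs_nonneg y) (by omega : m ≠ 0)).1 h
  rcases abs_eq_abs.1 h with h | h
  · exact (hxy h).elim
  · linarith

/-- If three distinct reals in `[-2, 2]` are the roots of a monic integral cubic and of a trinomial
`X ^ n - b X - a`, then their sum is zero. -/
lemma sum_eq_zero_of_pow_eq_affine {n : ℕ} (hn : 2 ≤ n)
    {a b x y z : ℝ} (hyx : y < x) (hzy : z < y) (hx2 : x ≤ 2) (hz2 : -2 ≤ z)
    (ex : x ^ n = b * x + a) (ey : y ^ n = b * y + a) (ez : z ^ n = b * z + a)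
    {s t p : ℤ} (hs : x + y + z = s) (ht : x * y + y * z + z * x = t) (hp : x * y * z = p) :
    x + y + z = 0 := by
  rcases Nat.even_or_odd n with he | ho
  · exact (not_three_pow_eq_affine_of_even hn he hzy hyx ez ey ex).elim
  rcases lt_trichotomy (x * y * z) 0 with h | h | h
  -- As `n` is odd, the reflection `u ↦ -u` preserves the setting and makes the product positive.
  · have := sum_eq_zero_of_pow_eq_affine_of_prod_pos (a := -a) (b := b) (x := -z) (y := -y)
      (z := -x) (s := -s) (t := t) (p := -p) hn ho (by linarith) (by linarith) (by linarith)
      (by linarith) (by rw [ho.neg_pow]; linarith) (by rw [ho.neg_pow]; linarith)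
      (by rw [ho.neg_pow]; linarith) (by push_cast; linarith) (by linarith)
      (by push_cast; linarith) (by linarith)
    linarith
  · have h0 : (0 : ℝ) ^ n = 0 := zero_pow (by omega)
    rcases mul_eq_zero.1 h with h | rfl
    · rcases mul_eq_zero.1 h with rfl | rfl
      · obtain rfl : a = 0 := by linarith
        have := add_eq_zero_of_pow_eq_mul (b := b) ho hyx.ne (hzy.trans hyx).ne hzy.ne'
          (by linarith) (by linarith) hn
        linarith
      · obtain rfl : a = 0 := by linarith
        have := add_eq_zero_of_pow_eq_mul (b := b) ho hyx.ne' hzy.ne (hzy.trans hyx).ne'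
          (by linarith) (by linarith) hn
        linarith
    · obtain rfl : a = 0 := by linarith
      have := add_eq_zero_of_pow_eq_mul (b := b) ho (hzy.trans hyx).ne' hzy.ne' hyx.ne'
        (by linarith) (by linarith) hn
      linarith
  · exact sum_eq_zero_of_pow_eq_affine_of_prod_pos hn ho hyx hzy hx2 hz2 ex ey ez hs ht hp h

/-- A trinomial `X ^ n - b X - a` has at most three distinct real roots. -/
lemma not_four_pow_eq_affine {n : ℕ} (hn : 2 ≤ n) {a b w x y z : ℝ}
    (hxw : x < w) (hyx : y < x) (hzy : z < y) (ew : w ^ n = b * w + a)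
    (ex : x ^ n = b * x + a) (ey : y ^ n = b * y + a) (ez : z ^ n = b * z + a) : False := by
  rcases Nat.even_or_odd n with he | ho
  · exact not_three_pow_eq_affine_of_even hn he hzy hyx ez ey ex
  rcases le_or_gt 0 y with hy | hy
  · exact not_three_pow_eq_affine_of_nonneg hn hy hyx hxw ey ex ew
  rcases le_or_gt x 0 with hx | hx
  · exact not_three_pow_eq_affine_of_nonneg (a := -a) (b := b) hn (x := -x) (y := -y) (z := -z)
      (by linarith) (by linarith) (by linarith) (by rw [ho.neg_pow]; linarith)
      (by rw [ho.neg_pow]; linarith) (by rw [ho.neg_pow]; linarith)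
  -- A line through two points of the graph with positive abscissas has negative intercept. The two
  -- positive roots give `a < 0`, the two reflected negative ones `-a < 0`.
  have key {u v c : ℝ} (hv : 0 < v) (huv : v < u) (eu : u ^ n = b * u + c)
      (ev : v ^ n = b * v + c) : c < 0 := by
    obtain ⟨m, rfl⟩ : ∃ m, n = m + 1 := ⟨n - 1, by omega⟩
    have hp : v ^ m < u ^ m := pow_lt_pow_left₀ huv hv.le (by omega)
    rw [pow_succ] at eu ev
    have h1 : v * u * (u ^ m - v ^ m) = -c * (u - v) := by linear_combination v * eu - u * ev
    have h2 : 0 < v * u * (u ^ m - v ^ m) :=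
      mul_pos (mul_pos hv (hv.trans huv)) (by linarith)
    rw [h1] at h2
    linarith [pos_of_mul_pos_left h2 (by linarith)]
  have h1 := key hx hxw ew ex
  have h2 := key (c := -a) (by linarith : 0 < -y) (by linarith : -y < -z)
    (by rw [ho.neg_pow]; linarith) (by rw [ho.neg_pow]; linarith)
  linarith

/-! ### Elimination of integral cubics by irrationality and trace identities -/

section Cubic

open Polynomial

lemma natDegree_X_pow_three_sub (p : ℤ) :
    (X ^ 3 - C 3 * X - C (p : ℚ) : ℚ[X]).natDegree = 3 := by
  compute_degree!

lemma irreducible_X_pow_three_sub {p : ℤ} (hp : p = 1 ∨ p = -1) :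
    Irreducible (X ^ 3 - C 3 * X - C (p : ℚ) : ℚ[X]) := by
  have hm : (X ^ 3 - C 3 * X - C (p : ℤ) : ℤ[X]).Monic := by monicity!
  have hd := natDegree_X_pow_three_sub p
  rw [Polynomial.irreducible_iff_roots_eq_zero_of_degree_le_three (by omega) (by omega)]
  refine Multiset.eq_zero_of_forall_notMem fun r hr => ?_
  have hr0 : r ^ 3 - 3 * r - p = 0 := by simpa using (mem_roots'.1 hr).2
  obtain ⟨z, rfl⟩ : ∃ z : ℤ, (z : ℚ) = r := by
    have : IsIntegral ℤ r := ⟨_, hm, by simpa [eval₂_eq_eval_map] using hr0⟩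
    exact IsIntegrallyClosed.isIntegral_iff.1 this
  have hz : z * (z ^ 2 - 3) = p := by
    have : ((z * (z ^ 2 - 3) : ℤ) : ℚ) = p := by push_cast; linarith
    exact_mod_cast this
  have hu : IsUnit z := isUnit_of_mul_isUnit_left (y := z ^ 2 - 3) (by
    rw [hz, Int.isUnit_iff]; exact hp)
  rcases Int.isUnit_iff.1 hu with rfl | rfl <;> rcases hp with rfl | rfl <;> norm_num at hz

lemma eq_zero_of_quadratic_of_cubic {p : ℤ} (hp : p = 1 ∨ p = -1) {x : ℝ}
    (hx : x ^ 3 - 3 * x - p = 0) {a b c : ℤ} (h : a * x ^ 2 + b * x + c = 0) : a = 0 := by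
  by_contra ha
  set q : ℚ[X] := C (a : ℚ) * X ^ 2 + C (b : ℚ) * X + C (c : ℚ) with hq
  have hdeg : q.natDegree = 2 := natDegree_quadratic (by exact_mod_cast ha)
  have hq0 : q ≠ 0 := by rintro h0; simp [h0] at hdeg
  have hmin := minpoly.eq_of_irreducible_of_monic (irreducible_X_pow_three_sub hp) (x := x)
    (by simpa using hx) (by monicity!)
  have := natDegree_le_natDegree (minpoly.degree_le_of_ne_zero ℚ x hq0 (by simpa [hq] using h))
  rw [← hmin, natDegree_X_pow_three_sub, hdeg] at this
  omega

end Cubic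

lemma int_eq_zero_of_add_eq_zero {x : ℝ} (hx : Irrational x) {a b : ℤ} (h : a * x + b = 0) :
    a = 0 := by
  by_contra ha
  exact (hx.intCast_mul ha).add_intCast b ⟨0, by push_cast; linarith⟩

lemma irrational_of_sq_eq_two_or_three {x : ℝ} (h : x ^ 2 = 2 ∨ x ^ 2 = 3) : Irrational x := by
  have key (p : ℕ) (hp : p.Prime) (hx : x ^ 2 = p) : Irrational x := by
    have h1 := hp.irrational_sqrt
    rw [← hx, Real.sqrt_sq_eq_abs] at h1
    rcases abs_choice x with h2 | h2 <;> rw [h2] at h1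
    · exact h1
    · simpa using h1.neg
  rcases h with h | h
  · exact key 2 (by norm_num) (by simpa using h)
  · exact key 3 (by norm_num) (by simpa using h)

lemma irrational_of_sq_eq_add_one {x : ℝ} (h : x ^ 2 = x + 1) : Irrational x := by
  have h5 : Irrational (√5) := by simpa using Nat.Prime.irrational_sqrt (p := 5) (by norm_num)
  have : (2 * x - 1) ^ 2 = 5 := by linear_combination 4 * h
  rw [← this, Real.sqrt_sq_eq_abs] at h5
  rintro ⟨q, rfl⟩
  exact h5 ⟨|2 * q - 1|, by push_cast; rfl⟩

/-- Here the cubic is `(X + 1)(X² - X - 1)`. Irrationality of the golden ratio equates the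
multiplicities of its two conjugates, and the second moment then becomes a divisibility that fails.
-/
lemma golden_absurd_of_prod_eq_one {x y z : ℝ} (hyx : y < x) (hzy : z < y) (hx2 : x < 2)
    (ht : x * y + y * z + z * x = -2) (hs : x + y + z = 0) (hp : x * y * z = 1)
    {d l m n : ℕ} (hl : 1 ≤ l)
    (h1 : 2 + l * x + m * y + n * z = 0)
    (h2 : d * (4 + l * x ^ 2 + m * y ^ 2 + n * z ^ 2) = 4 * (1 + l + m + n)) : False := by
  have hf : (x + 1) * (x ^ 2 - x - 1) = 0 := by
    linear_combination x ^ 2 * hs - x * ht + hp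
  have hxx : x ^ 2 = x + 1 := by
    rcases mul_eq_zero.1 hf with h | h <;> linarith
  have hzz : z = -1 := by
    have : (z + 1) * (y + 1) = 0 := by linear_combination ht + hxx - (x - 1) * hs
    rcases mul_eq_zero.1 this with h | h <;> linarith
  subst hzz
  obtain rfl : y = 1 - x := by linarith
  have h0 := int_eq_zero_of_add_eq_zero (irrational_of_sq_eq_add_one hxx) (a := l - m)
    (b := 2 + m - n) (by push_cast; linarith)
  obtain rfl : l = m := by omega
  have h0 : (n : ℝ) = l + 2 := by linarith
  obtain rfl : n = l + 2 := by exact_mod_cast h0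
  push_cast at h2
  have h3 : (d : ℝ) * (2 * l + 3) = 6 * (l + 1) := by
    linear_combination h2 / 2 - d * l * hxx
  have h3 : d * (2 * l + 3) = 6 * (l + 1) := by exact_mod_cast h3
  have h4 : 2 * l + 3 ∣ 3 := by
    have : 2 * l + 3 ∣ 3 * (2 * l + 3) - 6 * (l + 1) :=
      Nat.dvd_sub (dvd_mul_left _ _) ⟨d, by rw [← h3]; ring⟩
    rwa [show 3 * (2 * l + 3) - 6 * (l + 1) = 3 by omega] at this
  have := Nat.le_of_dvd (by norm_num) h4
  omega

lemma golden_absurd_of_prod_eq_neg_one {x y z : ℝ} (hyx : y < x) (hzy : z < y) (hz2 : -2 ≤ z)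
    (ht : x * y + y * z + z * x = -2) (hs : x + y + z = 0) (hp : x * y * z = -1)
    {d l m n : ℕ} (hl : 1 ≤ l)
    (h1 : 2 + l * x + m * y + n * z = 0)
    (h2 : d * (4 + l * x ^ 2 + m * y ^ 2 + n * z ^ 2) = 4 * (1 + l + m + n)) : False := by
  have hf : (z - 1) * (z ^ 2 + z - 1) = 0 := by
    linear_combination z ^ 2 * hs - z * ht + hp
  have hzz : z ^ 2 = -z + 1 := by
    rcases mul_eq_zero.1 hf with h | h <;> linarith
  have hx1 : x = 1 := by
    have : (x - 1) * (y - 1) = 0 := by linear_combination ht + hzz - (z + 1) * hs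
    rcases mul_eq_zero.1 this with h | h <;> linarith
  subst hx1
  obtain rfl : y = -1 - z := by linarith
  have hirr : Irrational (-z) := irrational_of_sq_eq_add_one (by linarith)
  have h0 := int_eq_zero_of_add_eq_zero hirr (a := m - n)
    (b := 2 + l - m) (by push_cast; linarith)
  obtain rfl : m = n := by omega
  have h0 : (m : ℝ) = l + 2 := by linarith
  obtain rfl : m = l + 2 := by exact_mod_cast h0
  push_cast at h2
  have h3 : (d : ℝ) * (2 * l + 5) = 2 * (3 * l + 5) := by
    linear_combination h2 / 2 - d * (l + 2) * hzz
  have h3 : d * (2 * l + 5) = 2 * (3 * l + 5) := by exact_mod_cast h3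
  have h4 : 2 * l + 5 ∣ 5 := by
    have : 2 * l + 5 ∣ 3 * (2 * l + 5) - 2 * (3 * l + 5) :=
      Nat.dvd_sub (dvd_mul_left _ _) ⟨d, by rw [← h3]; ring⟩
    rwa [show 3 * (2 * l + 5) - 2 * (3 * l + 5) = 5 by omega] at this
  have := Nat.le_of_dvd (by norm_num) h4
  omega

/-- Eliminating `y` between the linear relation and `x² + xy + y² = 3` gives an integral quadratic
relation for `x`, of degree 3 over `ℚ`. Its leading coefficient is a positive definite form in `l -
n` and `m - n`, so `l = m = n`, and `h1` reads `2 = 0`. -/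
lemma irreducible_cubic_absurd {x y z : ℝ} {p : ℤ} (hp1 : p = 1 ∨ p = -1)
    (ht : x * y + y * z + z * x = -3) (hs : x + y + z = 0) (hp : x * y * z = p)
    {l m n : ℕ} (h1 : 2 + l * x + m * y + n * z = 0) : False := by
  have hcub : x ^ 3 - 3 * x - p = 0 := by
    linear_combination x ^ 2 * hs - x * ht + hp
  obtain rfl : z = -x - y := by linarith
  have hE : 2 + (l - n) * x + (m - n) * y = 0 := by linarith
  have h0 := eq_zero_of_quadratic_of_cubic hp1 hcub
    (a := (m - n) ^ 2 - (l - n) * (m - n) + (l - n) ^ 2) (b := 4 * (l - n) - 2 * (m - n))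
    (c := 4 - 3 * (m - n) ^ 2) (by
      push_cast
      linear_combination (-(m - n : ℝ) ^ 2) * ht
        - (x * (m - n) + (m - n) * y - 2 - x * (l - n)) * hE)
  have hmn : (m : ℤ) - n = 0 := by
    by_contra h
    have := pow_pos (abs_pos.2 h) 2
    rw [sq_abs] at this
    nlinarith [sq_nonneg ((m : ℤ) - n - 2 * (l - n))]
  have hln : (l : ℤ) - n = 0 := by
    rw [hmn] at h0
    simpa using h0
  obtain rfl : m = n := by omega
  obtain rfl : l = m := by omega
  linarith

/-- The cubics with integral coefficients, sum of roots zero and three distinct roots in `[-2, 2)`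
that are compatible with the first two moments of a spectrum with multiplicities. -/
lemma eq_one_zero_neg_one {x y z : ℝ} (hyx : y < x) (hzy : z < y) (hx2 : x < 2) (hz2 : -2 ≤ z)
    {t p : ℤ} (hs : x + y + z = 0) (ht : x * y + y * z + z * x = t) (hp : x * y * z = p)
    {d l m n : ℕ} (hl : 1 ≤ l)
    (h1 : 2 + l * x + m * y + n * z = 0)
    (h2 : d * (4 + l * x ^ 2 + m * y ^ 2 + n * z ^ 2) = 4 * (1 + l + m + n)) :
    x = 1 ∧ y = 0 ∧ z = -1 := by
  have hx : 0 < x := by linarith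
  have hz : z < 0 := by linarith
  obtain rfl : x = -y - z := by linarith
  have ht' : y ^ 2 + y * z + z ^ 2 = -t := by linear_combination -ht
  -- For `X³ + tX - p`: the discriminant is positive, the value at `2` is positive and the value at
  -- `-2` is nonpositive.
  have hdisc : (0 : ℝ) < -4 * t ^ 3 - 27 * p ^ 2 := by
    have : ((-y - z - y) * (-y - z - z) * (y - z)) ^ 2 = -4 * (t : ℝ) ^ 3 - 27 * p ^ 2 := by
      rw [← ht, ← hp]; ring
    rw [← this]
    exact pow_pos (mul_pos (mul_pos (by linarith) (by linarith)) (by linarith)) 2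
  have hA : (0 : ℝ) < 8 + 2 * t - p := by
    have : (2 - (-y - z)) * (2 - y) * (2 - z) = 8 + 2 * (t : ℝ) - p := by
      rw [← ht, ← hp]; ring
    rw [← this]
    exact mul_pos (mul_pos (by linarith) (by linarith)) (by linarith)
  have hB : (0 : ℝ) ≤ 8 + 2 * t + p := by
    have : (2 + (-y - z)) * (2 + y) * (2 + z) = 8 + 2 * (t : ℝ) + p := by
      rw [← ht, ← hp]; ring
    rw [← this]
    exact mul_nonneg (mul_nonneg (by linarith) (by linarith)) (by linarith)
  have htneg : (t : ℝ) < 0 := by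
    have := sq_nonneg (y + z)
    have := mul_pos_of_neg_of_neg hz hz
    nlinarith [sq_nonneg y]
  have hdisc : 0 < -4 * t ^ 3 - 27 * p ^ 2 := by exact_mod_cast hdisc
  have hA : 0 < 8 + 2 * t - p := by exact_mod_cast hA
  have hB : 0 ≤ 8 + 2 * t + p := by exact_mod_cast hB
  have htneg : t < 0 := by exact_mod_cast htneg
  -- Adding `hA` and `hB` bounds `t`; the discriminant then bounds `p`.
  have ht4 : -4 < t := by omega
  have hp2 : p ≤ 1 := by
    by_contra! h
    nlinarith [sq_nonneg (t + 3), mul_nonneg (sq_nonneg t) (by omega : 0 ≤ t + 3)]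
  have hp3 : -1 ≤ p := by
    by_contra! h
    nlinarith [sq_nonneg (t + 3), mul_nonneg (sq_nonneg t) (by omega : 0 ≤ t + 3)]
  have hpz : p = 0 ∨ p = 1 ∨ p = -1 := by omega
  have htz : t = -1 ∨ t = -2 ∨ t = -3 := by omega
  have zero_case (h0 : p = 0) : y = 0 ∧ z ^ 2 = -t := by
    rw [h0, Int.cast_zero] at hp
    have hy : y = 0 := by
      rcases mul_eq_zero.1 hp with h | h
      · rcases mul_eq_zero.1 h with h | h
        · linarith
        · exact h
      · linarith
    subst hy
    exact ⟨rfl, by linarith⟩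
  rcases hpz with rfl | hp1
  · obtain ⟨rfl, hz2⟩ := zero_case rfl
    rcases htz with rfl | ht2
    · have : z = -1 := by
        have : (z - 1) * (z + 1) = 0 := by push_cast at hz2; linarith
        rcases mul_eq_zero.1 this with h | h <;> linarith
      subst this
      norm_num
    · exfalso
      have hirr : Irrational z := irrational_of_sq_eq_two_or_three (by
        rcases ht2 with rfl | rfl <;> norm_num at hz2
        · exact Or.inl hz2
        · exact Or.inr hz2)
      have h0 := int_eq_zero_of_add_eq_zero hirr (a := n - l) (b := 2) (by push_cast; linarith)
      have h0 : (n : ℝ) = l := by exact_mod_cast (by omega : (n : ℤ) = l)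
      rw [h0] at h1
      linarith
  rcases htz with rfl | rfl | rfl
  · rcases hp1 with rfl | rfl <;> norm_num at hdisc
  · push_cast at ht
    rcases hp1 with rfl | rfl
    · exact (golden_absurd_of_prod_eq_one hyx hzy hx2 ht hs (by simpa using hp) hl h1 h2).elim
    · exact (golden_absurd_of_prod_eq_neg_one hyx hzy hz2 ht hs (by simpa using hp) hl h1 h2).elim
  · push_cast at ht
    exact (irreducible_cubic_absurd hp1 ht hs hp h1).elim

/-! ### Polynomials in a real symmetric matrix -/

namespace Matrix.IsHermitian

open Polynomial

variable {V : Type*} [Fintype V] [DecidableEq V] {A : Matrix V V ℝ}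

lemma aeval_eq_conj (hA : A.IsHermitian) (f : ℝ[X]) :
    aeval A f = Unitary.conjStarAlgAut ℝ _ hA.eigenvectorUnitary
      (diagonal fun i => f.eval (hA.eigenvalues i)) := by
  have hd : aeval (diagonal hA.eigenvalues) f =
      diagonal (fun i => f.eval (hA.eigenvalues i)) := by
    have := aeval_algHom_apply (Matrix.diagonalAlgHom ℝ (n := V) (α := ℝ)) hA.eigenvalues f
    rw [Matrix.diagonalAlgHom_apply] at this
    rw [this, aeval_pi_apply, Matrix.diagonalAlgHom_apply]
    rfl
  conv_lhs => rw [hA.spectral_theorem]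
  rw [← hd]
  exact aeval_algHom_apply
    (Unitary.conjStarAlgAut ℝ (Matrix V V ℝ) hA.eigenvectorUnitary).toAlgEquiv.toAlgHom _ f

lemma aeval_eq_zero (hA : A.IsHermitian) {f : ℝ[X]} (hf : ∀ r ∈ A.charpoly.roots, f.eval r = 0) :
    aeval A f = 0 := by
  have h : (fun i => f.eval (hA.eigenvalues i)) = 0 := by
    ext i
    refine hf _ ?_
    rw [hA.roots_charpoly_eq_eigenvalues]
    simp
  rw [hA.aeval_eq_conj, h]
  simp

lemma trace_aeval (hA : A.IsHermitian) (f : ℝ[X]) :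
    (aeval A f).trace = (A.charpoly.roots.map f.eval).sum := by
  rw [hA.aeval_eq_conj, Unitary.conjStarAlgAut_apply, Matrix.trace_mul_comm, ← mul_assoc,
    hA.roots_charpoly_eq_eigenvalues]
  simp [Matrix.trace]

end Matrix.IsHermitian

namespace Matrix

variable {V : Type*} [Fintype V] [DecidableEq V] {A : Matrix V V ℝ}

lemma mem_roots_charpoly_iff {r : ℝ} :
    r ∈ A.charpoly.roots ↔ ∃ v : V → ℝ, v ≠ 0 ∧ A *ᵥ v = r • v := by
  rw [Polynomial.mem_roots A.charpoly_monic.ne_zero, ← mem_spectrum_iff_isRoot_charpoly,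
    ← Matrix.spectrum_toLin', ← Module.End.hasEigenvalue_iff_mem_spectrum]
  constructor
  · intro h
    obtain ⟨v, hv⟩ := h.exists_hasEigenvector
    exact ⟨v, hv.2, by simpa using hv.apply_eq_smul⟩
  · rintro ⟨v, hv, h⟩
    exact Module.End.hasEigenvalue_of_hasEigenvector (x := v)
      (Module.End.hasEigenvector_iff.2 ⟨Module.End.mem_eigenspace_iff.2 (by simpa using h), hv⟩)

open Polynomial in
lemma aeval_mulVec_of_mulVec_eq_smul {r : ℝ} {v : V → ℝ} (h : A *ᵥ v = r • v) (f : ℝ[X]) :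
    aeval A f *ᵥ v = f.eval r • v := by
  induction f using Polynomial.induction_on' with
  | add p q hp hq => simp [add_mulVec, hp, hq, add_smul]
  | monomial n a =>
    have (n : ℕ) : A ^ n *ᵥ v = r ^ n • v := by
      induction n with
      | zero => simp
      | succ n ih => rw [pow_succ, ← mulVec_mulVec, h, mulVec_smul, ih, smul_smul, pow_succ']
    rw [aeval_monomial, ← Algebra.smul_def, smul_mulVec, this, eval_monomial, smul_smul]

end Matrix

/-! ### Rationality of the symmetric functions of the eigenvalues -/

section Rational

open Polynomial

/-- The monic polynomial with simple roots at the roots of a rational polynomial is rational. -/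
lemma exists_map_eq_prod_roots_toFinset {f : ℚ[X]} (hf : f ≠ 0)
    (hs : (f.map (algebraMap ℚ ℝ)).Splits) :
    ∃ g : ℚ[X], g.map (algebraMap ℚ ℝ) =
      ∏ r ∈ (f.map (algebraMap ℚ ℝ)).roots.toFinset, (X - C r) := by
  set F := f.map (algebraMap ℚ ℝ) with hF
  have hF0 : F ≠ 0 := (Polynomial.map_ne_zero_iff (algebraMap ℚ ℝ).injective).2 hf
  -- The radical has the same roots and is separable in characteristic zero, so its roots stay
  -- simple over `ℝ`.
  set g := UniqueFactorizationMonoid.radical f with hg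
  have hg0 : g ≠ 0 := UniqueFactorizationMonoid.radical_ne_zero
  have hgsep : g.Separable :=
    PerfectField.separable_iff_squarefree.2 UniqueFactorizationMonoid.squarefree_radical
  set H := g.map (algebraMap ℚ ℝ) with hH
  have hH0 : H ≠ 0 := (Polynomial.map_ne_zero_iff (algebraMap ℚ ℝ).injective).2 hg0
  have hdvd : H ∣ F := Polynomial.map_dvd _ UniqueFactorizationMonoid.radical_dvd_self
  have hHs : H.Splits := hs.of_dvd hF0 hdvd
  obtain ⟨n, hn⟩ := UniqueFactorizationMonoid.exists_dvd_radical_self_pow hf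
  have hdvd' : F ∣ H ^ n := by
    rw [hH, ← Polynomial.map_pow]
    exact Polynomial.map_dvd _ hn
  have hroots : H.roots = F.roots.toFinset.val := by
    have hnd : H.roots.Nodup := nodup_roots hgsep.map
    refine (Multiset.Nodup.ext hnd (Multiset.nodup_dedup _)).2 fun r => ?_
    rw [Multiset.mem_dedup, mem_roots hH0, mem_roots hF0]
    refine ⟨fun h => h.dvd hdvd, fun h => ?_⟩
    have h1 : (H ^ n).IsRoot r := h.dvd hdvd'
    rw [IsRoot.def, eval_pow] at h1
    exact eq_zero_of_pow_eq_zero h1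
  refine ⟨C g.leadingCoeff⁻¹ * g, ?_⟩
  have hprod := hHs.eq_prod_roots
  rw [hroots] at hprod
  rw [Polynomial.map_mul, map_C, ← hH, hprod, hH, leadingCoeff_map, ← mul_assoc, ← C_mul,
    ← map_mul, inv_mul_cancel₀ (leadingCoeff_ne_zero.2 hg0)]
  simp [Finset.prod]

/-- The monic quartic with these simple roots is rational and `k` is rational, so its coefficients
can be solved successively for the symmetric functions of the other three roots. -/
lemma exists_rat_elementary_symmetric {f : ℚ[X]} (hf : f ≠ 0)
    (hs : (f.map (algebraMap ℚ ℝ)).Splits) {k : ℚ} {x y z : ℝ} (hkx : x < k) (hyx : y < x)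
    (hzy : z < y) (hroots : (f.map (algebraMap ℚ ℝ)).roots.toFinset = {(k : ℝ), x, y, z}) :
    ∃ s t p : ℚ, x + y + z = s ∧ x * y + y * z + z * x = t ∧ x * y * z = p := by
  obtain ⟨g, hg⟩ := exists_map_eq_prod_roots_toFinset hf hs
  have hzx := hzy.trans hyx
  rw [hroots, Finset.prod_insert (by simp; exact ⟨hkx.ne', (hyx.trans hkx).ne', (hzx.trans hkx).ne'⟩),
    Finset.prod_insert (by simp; exact ⟨hyx.ne', hzx.ne'⟩),
    Finset.prod_insert (by simpa using hzy.ne'), Finset.prod_singleton] at hg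
  have hexp : (X - C (k : ℝ)) * ((X - C x) * ((X - C y) * (X - C z))) =
      X ^ 4 - C (k + (x + y + z)) * X ^ 3 + C (k * (x + y + z) + (x * y + y * z + z * x)) * X ^ 2
        - C (k * (x * y + y * z + z * x) + x * y * z) * X + C (k * (x * y * z)) := by
    simp only [map_add, map_mul]
    ring
  rw [hexp] at hg
  have hc (a b c e : ℝ) (h : g.map (algebraMap ℚ ℝ) =
      X ^ 4 - C a * X ^ 3 + C b * X ^ 2 - C c * X + C e) :
      (g.coeff 3 : ℝ) = -a ∧ (g.coeff 2 : ℝ) = b ∧ (g.coeff 1 : ℝ) = -c := by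
    refine ⟨?_, ?_, ?_⟩
    · simpa [coeff_X, coeff_C, coeff_X_pow] using congrArg (fun q => coeff q 3) h
    · simpa [coeff_X, coeff_C, coeff_X_pow] using congrArg (fun q => coeff q 2) h
    · simpa [coeff_X, coeff_C, coeff_X_pow] using congrArg (fun q => coeff q 1) h
  obtain ⟨h3, h2, h1⟩ := hc _ _ _ _ hg
  have es : x + y + z = ((-g.coeff 3 - k : ℚ) : ℝ) := by
    push_cast; linarith
  have et : x * y + y * z + z * x = ((g.coeff 2 - k * (-g.coeff 3 - k) : ℚ) : ℝ) := by
    push_cast at es ⊢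
    rw [← es]; linarith
  have ep : x * y * z =
      ((-g.coeff 1 - k * (g.coeff 2 - k * (-g.coeff 3 - k)) : ℚ) : ℝ) := by
    push_cast at et ⊢
    rw [← et]; linarith
  exact ⟨_, _, _, es, et, ep⟩

end Rational

/-! ### Eigenvalues of regular graphs -/

section Eigenvalues

open Matrix

variable {V : Type*} [Fintype V] [DecidableEq V] {G : SimpleGraph V} [DecidableRel G.Adj]

omit [Fintype V] [DecidableEq V] in
lemma SimpleGraph.isHermitian_adjMatrix_real : (G.adjMatrix ℝ).IsHermitian := by
  rw [Matrix.IsHermitian, conjTranspose_eq_transpose_of_trivial, G.transpose_adjMatrix]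

namespace SimpleGraph.IsRegularOfDegree

variable {d : ℕ}

lemma abs_le_of_mem_roots (hd : G.IsRegularOfDegree d) {r : ℝ}
    (hr : r ∈ (G.adjMatrix ℝ).charpoly.roots) : |r| ≤ d := by
  obtain ⟨v, hv, h⟩ := mem_roots_charpoly_iff.1 hr
  obtain ⟨x0, hx0⟩ := Function.ne_iff.1 hv
  obtain ⟨x, -, hx⟩ := Finset.exists_max_image Finset.univ (fun x => |v x|) ⟨x0, Finset.mem_univ _⟩
  have hpos : 0 < |v x| := (abs_pos.2 hx0).trans_le (hx x0 (Finset.mem_univ _))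
  have h1 := congrFun h x
  rw [adjMatrix_mulVec_apply, Pi.smul_apply, smul_eq_mul] at h1
  have h2 : |r| * |v x| ≤ d * |v x| := by
    rw [← abs_mul, ← h1]
    refine (Finset.abs_sum_le_sum_abs _ _).trans ?_
    refine (Finset.sum_le_card_nsmul _ _ _ fun y _ => hx y (Finset.mem_univ _)).trans ?_
    rw [card_neighborFinset_eq_degree, hd x, nsmul_eq_mul]
  exact le_of_mul_le_mul_right h2 hpos

omit [DecidableEq V] in
lemma adjMatrix_mulVec_one (hd : G.IsRegularOfDegree d) :
    G.adjMatrix ℝ *ᵥ (1 : V → ℝ) = (d : ℝ) • (1 : V → ℝ) := by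
  ext x
  rw [adjMatrix_mulVec_apply]
  simp [hd x]

lemma mem_roots [Nonempty V] (hd : G.IsRegularOfDegree d) :
    (d : ℝ) ∈ (G.adjMatrix ℝ).charpoly.roots :=
  mem_roots_charpoly_iff.2 ⟨1, one_ne_zero, hd.adjMatrix_mulVec_one⟩

omit [DecidableEq V] in
lemma sum_eq_zero_of_mulVec_eq_smul (hd : G.IsRegularOfDegree d) {r : ℝ} (hr : r ≠ d) {v : V → ℝ}
    (hv : G.adjMatrix ℝ *ᵥ v = r • v) : ∑ x, v x = 0 := by
  have h : (1 : V → ℝ) ⬝ᵥ (G.adjMatrix ℝ *ᵥ v) = d * ∑ x, v x := by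
    rw [dotProduct_mulVec, ← mulVec_transpose, transpose_adjMatrix, hd.adjMatrix_mulVec_one]
    simp [dotProduct, Finset.mul_sum]
  rw [hv] at h
  have h2 : (r - d) * ∑ x, v x = 0 := by
    rw [sub_mul, ← h]
    simp [dotProduct, Finset.mul_sum]
  exact (mul_eq_zero.1 h2).resolve_left (sub_ne_zero.2 hr)

end SimpleGraph.IsRegularOfDegree

end Eigenvalues

/-! ### Strongly walk-regular graphs: regularity and walk-regularity -/

namespace GroverWalk

open Matrix Polynomial

variable {V : Type*} [Fintype V] [DecidableEq V] {G : SimpleGraph V} [DecidableRel G.Adj]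

lemma aeval_trinomial {A M : Matrix V V ℝ} {n : ℕ} {a b : ℝ}
    (h : A ^ n = a • (1 : Matrix V V ℝ) + b • A + M) :
    aeval A (X ^ n - C b * X - C a) = M := by
  simp only [map_sub, map_mul, map_pow, aeval_X, aeval_C, h, Algebra.algebraMap_eq_smul_one,
    smul_mul_assoc, one_mul]
  abel

/-- `c J` is a polynomial in `A`, hence commutes with it; comparing entries of `AJ` and `JA`
compares degrees. -/
lemma isRegularOfDegree_of_pow_eq [Nonempty V] {n : ℕ} {a b c : ℝ} (hc : c ≠ 0)
    (h : G.adjMatrix ℝ ^ n = a • (1 : Matrix V V ℝ) + b • G.adjMatrix ℝ +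
      c • Matrix.of fun (_ _ : V) => (1 : ℝ)) :
    ∃ d : ℕ, G.IsRegularOfDegree d := by
  have hcomm : G.adjMatrix ℝ * (c • Matrix.of fun (_ _ : V) => (1 : ℝ)) =
      (c • Matrix.of fun _ _ => 1) * G.adjMatrix ℝ := by
    rw [← aeval_trinomial h]
    have := aeval_mul (R := ℝ) (x := G.adjMatrix ℝ) (p := X) (q := X ^ n - C b * X - C a)
    rw [mul_comm, aeval_mul, aeval_X] at this
    exact this.symm
  have hdeg (x y : V) : G.degree x = G.degree y := by
    have h1 := congrFun (congrFun hcomm x) y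
    rw [SimpleGraph.adjMatrix_mul_apply, SimpleGraph.mul_adjMatrix_apply] at h1
    have h2 : (G.degree x : ℝ) * c = G.degree y * c := by simpa using h1
    exact_mod_cast mul_right_cancel₀ hc h2
  exact ⟨G.degree (Classical.arbitrary V), fun x => hdeg _ _⟩

lemma ne_zero_of_pow_eq {n : ℕ} (hn : 2 ≤ n) {a b c : ℝ} {k x y z : ℝ} (hxk : x < k)
    (hyx : y < x) (hzy : z < y) (hspec : distinctEigenvalues G = {k, x, y, z})
    (h : G.adjMatrix ℝ ^ n = a • (1 : Matrix V V ℝ) + b • G.adjMatrix ℝ +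
      c • Matrix.of fun (_ _ : V) => (1 : ℝ)) : c ≠ 0 := by
  rintro rfl
  rw [zero_smul] at h
  have key (r : ℝ) (hr : r ∈ distinctEigenvalues G) : r ^ n = b * r + a := by
    rw [distinctEigenvalues, graphSpectrum, Multiset.mem_toFinset] at hr
    obtain ⟨v, hv, h1⟩ := mem_roots_charpoly_iff.1 hr
    have h2 := aeval_mulVec_of_mulVec_eq_smul h1 (X ^ n - C b * X - C a)
    rw [aeval_trinomial h, zero_mulVec] at h2
    have h3 := (smul_eq_zero.1 h2.symm).resolve_right hv
    simp at h3
    linarith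
  rw [hspec] at key
  exact not_four_pow_eq_affine hn hxk hyx hzy (key _ (by simp)) (key _ (by simp))
    (key _ (by simp)) (key _ (by simp))

section Regular

variable {d n : ℕ} {a b c : ℝ}

lemma eval_trinomial_eq_zero (hd : G.IsRegularOfDegree d)
    (h : G.adjMatrix ℝ ^ n = a • (1 : Matrix V V ℝ) + b • G.adjMatrix ℝ +
      c • Matrix.of fun (_ _ : V) => (1 : ℝ))
    {r : ℝ} (hr : r ∈ graphSpectrum G) (hrd : r ≠ d) :
    (X ^ n - C b * X - C a : ℝ[X]).eval r = 0 := by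
  obtain ⟨v, hv, h1⟩ := mem_roots_charpoly_iff.1 hr
  have h2 := aeval_mulVec_of_mulVec_eq_smul h1 (X ^ n - C b * X - C a)
  have h3 : (c • Matrix.of fun (_ _ : V) => (1 : ℝ)) *ᵥ v = 0 := by
    ext x
    simp [mulVec, dotProduct, ← Finset.mul_sum, hd.sum_eq_zero_of_mulVec_eq_smul hrd h1]
  rw [aeval_trinomial h, h3] at h2
  exact (smul_eq_zero.1 h2.symm).resolve_right hv

lemma eval_trinomial_degree [Nonempty V] (hd : G.IsRegularOfDegree d)
    (h : G.adjMatrix ℝ ^ n = a • (1 : Matrix V V ℝ) + b • G.adjMatrix ℝ +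
      c • Matrix.of fun (_ _ : V) => (1 : ℝ))
    :
    (X ^ n - C b * X - C a : ℝ[X]).eval (d : ℝ) = c * Fintype.card V := by
  have h2 := aeval_mulVec_of_mulVec_eq_smul hd.adjMatrix_mulVec_one (X ^ n - C b * X - C a)
  rw [aeval_trinomial h] at h2
  have h3 := congrFun h2 (Classical.arbitrary V)
  rw [Pi.smul_apply, Pi.one_apply, smul_eq_mul, mul_one] at h3
  rw [← h3]
  simp [mulVec, dotProduct, mul_comm]

/-- The trinomial at `A` is `c J`, of trace `c |V|`. Only the eigenvalue `d` contributes to this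
trace, each occurrence giving `c |V|`. -/
lemma count_graphSpectrum_degree [Nonempty V] (hd : G.IsRegularOfDegree d)
    (h : G.adjMatrix ℝ ^ n = a • (1 : Matrix V V ℝ) + b • G.adjMatrix ℝ +
      c • Matrix.of fun (_ _ : V) => (1 : ℝ))
    (hc : c ≠ 0) :
    (graphSpectrum G).count (d : ℝ) = 1 := by
  have htr := SimpleGraph.isHermitian_adjMatrix_real.trace_aeval (A := G.adjMatrix ℝ)
    (X ^ n - C b * X - C a)
  rw [aeval_trinomial h, ← graphSpectrum, Finset.sum_multiset_map_count] at htr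
  rw [Finset.sum_eq_single (d : ℝ)] at htr
  · rw [eval_trinomial_degree hd h] at htr
    have h1 : (Fintype.card V : ℝ) ≠ 0 := by simp
    have h2 : c * Fintype.card V = (graphSpectrum G).count (d : ℝ) * (c * Fintype.card V) := by
      rw [← nsmul_eq_mul, ← htr]
      simp [Matrix.trace, mul_comm]
    have h3 := mul_right_cancel₀ (mul_ne_zero hc h1) ((one_mul _).trans h2)
    exact_mod_cast h3.symm
  · intro r hr hrd
    rw [eval_trinomial_eq_zero hd h (Multiset.mem_toFinset.1 hr) hrd, smul_zero]
  · intro h0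
    rw [Multiset.count_eq_zero.2 fun h1 => h0 (Multiset.mem_toFinset.2 h1), zero_smul]

/-- A regular graph with at most four distinct eigenvalues is walk-regular. -/
lemma aeval_adjMatrix_diag_eq [Nonempty V] (hd : G.IsRegularOfDegree d)
    (h : G.adjMatrix ℝ ^ n = a • (1 : Matrix V V ℝ) + b • G.adjMatrix ℝ +
      c • Matrix.of fun (_ _ : V) => (1 : ℝ))
    (hc : c ≠ 0) {x y z : ℝ}
    (hspec : ∀ r ∈ graphSpectrum G, r = d ∨ r = x ∨ r = y ∨ r = z) (f : ℝ[X]) (u w : V) :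
    aeval (G.adjMatrix ℝ) f u u = aeval (G.adjMatrix ℝ) f w w := by
  set P : ℝ[X] := X ^ n - C b * X - C a with hP
  set g : ℝ[X] := (X - C x) * (X - C y) * (X - C z) with hg
  have hgm : g.Monic := ((monic_X_sub_C x).mul (monic_X_sub_C y)).mul (monic_X_sub_C z)
  have hgd : g.natDegree = 3 := by
    rw [hg, (((monic_X_sub_C x).mul (monic_X_sub_C y))).natDegree_mul (monic_X_sub_C z),
      (monic_X_sub_C x).natDegree_mul (monic_X_sub_C y)]
    simp
  have hPd : P.eval (d : ℝ) ≠ 0 := by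
    rw [hP, eval_trinomial_degree hd h]
    exact mul_ne_zero hc (by simp)
  -- `κ` makes `g * (f /ₘ g)` and `κ P` agree at `d`; both vanish at all other eigenvalues. So the
  -- quotient part of `f` at `A` is a multiple of `J`, and the remainder involves only `I`, `A`,
  -- `A²`, all of constant diagonal.
  set κ : ℝ := (g * (f /ₘ g)).eval (d : ℝ) / P.eval (d : ℝ) with hκ
  have hzero : aeval (G.adjMatrix ℝ) (g * (f /ₘ g) - C κ * P) = 0 := by
    refine SimpleGraph.isHermitian_adjMatrix_real.aeval_eq_zero fun r hr => ?_
    by_cases hrd : r = d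
    · rw [hrd, eval_sub, eval_mul (p := C κ), eval_C, hκ, div_mul_cancel₀ _ hPd, sub_self]
    · have hgr : g.eval r = 0 := by
        rcases (hspec r hr).resolve_left hrd with rfl | rfl | rfl <;> simp [hg]
      rw [eval_sub, eval_mul, hgr, eval_mul, hP, eval_trinomial_eq_zero hd h hr hrd]
      simp
  have hrem : f %ₘ g = C ((f %ₘ g).coeff 0) + C ((f %ₘ g).coeff 1) * X +
      C ((f %ₘ g).coeff 2) * X ^ 2 := by
    have hlt : (f %ₘ g).natDegree < 3 := by
      rw [← hgd]
      exact natDegree_modByMonic_lt f hgm (by rintro h1; simp [h1] at hgd)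
    conv_lhs => rw [as_sum_range_C_mul_X_pow' _ hlt]
    simp [Finset.sum_range_succ]
  have hf : aeval (G.adjMatrix ℝ) f = aeval (G.adjMatrix ℝ) (f %ₘ g) +
      κ • c • Matrix.of fun (_ _ : V) => (1 : ℝ) := by
    conv_lhs => rw [← modByMonic_add_div f g]
    rw [map_sub, sub_eq_zero] at hzero
    rw [map_add, hzero, map_mul, aeval_C, hP, aeval_trinomial h, Algebra.algebraMap_eq_smul_one,
      smul_mul_assoc, one_mul]
  rw [hf, hrem]
  have hdiag (v : V) : (G.adjMatrix ℝ ^ 2) v v = d := by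
    rw [pow_two, SimpleGraph.adjMatrix_mul_self_apply_self, hd v]
  simp [Algebra.algebraMap_eq_smul_one, hdiag]

end Regular

/-! ### The Grover walk and Chebyshev polynomials -/

variable {d : ℕ}

lemma shiftMatrix_mul_apply {W : Type*} (M : Matrix G.Dart W ℂ) (a : G.Dart) (w : W) :
    (shiftMatrix G * M) a w = M a.symm w := by
  rw [Matrix.mul_apply, Finset.sum_eq_single a.symm]
  · simp [shiftMatrix]
  · intro b _ hb
    have : a ≠ b.symm := by
      rintro rfl
      simp at hb
    simp [shiftMatrix, this]
  · simp

lemma shiftMatrix_mul_self : shiftMatrix G * shiftMatrix G = 1 := by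
  ext a b
  rw [shiftMatrix_mul_apply, shiftMatrix, Matrix.of_apply, Matrix.one_apply]
  simp only [SimpleGraph.Dart.symm_involutive.injective.eq_iff]

lemma card_dart_snd_eq (x : V) :
    (Finset.univ.filter fun a : G.Dart => x = a.snd).card = G.degree x := by
  rw [← G.dart_fst_fiber_card_eq_degree x]
  refine Finset.card_bij (fun a _ => a.symm) ?_ ?_ ?_
  · simp [eq_comm]
  · exact fun a _ b _ h => SimpleGraph.Dart.symm_involutive.injective h
  · intro b hb
    exact ⟨b.symm, by simpa [eq_comm] using hb, by simp⟩

lemma ofReal_one_div_sqrt_mul_self (hd0 : 0 < d) :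
    ((1 / Real.sqrt d : ℝ) : ℂ) * ((1 / Real.sqrt d : ℝ) : ℂ) = ((1 / d : ℝ) : ℂ) := by
  rw [← Complex.ofReal_mul, div_mul_div_comm, Real.mul_self_sqrt (by positivity), one_mul]

lemma boundaryMatrix_mul_conjTranspose (hd : G.IsRegularOfDegree d) (hd0 : 0 < d) :
    boundaryMatrix G * (boundaryMatrix G)ᴴ = 1 := by
  ext x y
  have hd' : (d : ℂ) ≠ 0 := by exact_mod_cast hd0.ne'
  rw [Matrix.mul_apply, Matrix.one_apply]
  split_ifs with h
  · subst h
    have (a : G.Dart) : boundaryMatrix G x a * (boundaryMatrix G)ᴴ a x =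
        if x = a.snd then ((1 / d : ℝ) : ℂ) else 0 := by
      rw [conjTranspose_apply, boundaryMatrix, of_apply, hd x]
      split_ifs
      · rw [← ofReal_one_div_sqrt_mul_self hd0, ← starRingEnd_apply, Complex.conj_ofReal]
      · simp
    simp only [this]
    rw [← Finset.sum_filter, Finset.sum_const, nsmul_eq_mul]
    rw [card_dart_snd_eq, hd x]
    push_cast
    field_simp
  · refine Finset.sum_eq_zero fun a _ => ?_
    rw [conjTranspose_apply, boundaryMatrix, of_apply, of_apply]
    by_cases hx : x = a.snd
    · rw [if_neg (fun hy : y = a.snd => h (hx.trans hy.symm))]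
      simp
    · simp [hx]

lemma boundaryMatrix_mul_shiftMatrix_mul (hd : G.IsRegularOfDegree d) (hd0 : 0 < d) :
    boundaryMatrix G * (shiftMatrix G * (boundaryMatrix G)ᴴ) =
      ((1 / d : ℝ) • G.adjMatrix ℝ).map Complex.ofRealHom := by
  ext x y
  have (a : G.Dart) : boundaryMatrix G x a * (shiftMatrix G * (boundaryMatrix G)ᴴ) a y =
      if x = a.snd ∧ y = a.fst then ((1 / d : ℝ) : ℂ) else 0 := by
    rw [shiftMatrix_mul_apply, conjTranspose_apply, boundaryMatrix, of_apply, of_apply, hd x, hd y]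
    by_cases hx : x = a.snd <;> by_cases hy : y = a.fst
    · rw [if_pos hx, if_pos (by simpa using hy), if_pos ⟨hx, hy⟩,
        ← ofReal_one_div_sqrt_mul_self hd0, ← starRingEnd_apply, Complex.conj_ofReal]
    all_goals simp [hx, hy]
  rw [Matrix.mul_apply]
  simp only [this, map_apply, Matrix.smul_apply, SimpleGraph.adjMatrix_apply, smul_eq_mul]
  by_cases hadj : G.Adj x y
  · rw [Finset.sum_eq_single (⟨(y, x), hadj.symm⟩ : G.Dart)]
    · simp [hadj]
    · intro b _ hb
      refine if_neg fun h => hb ?_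
      ext
      · exact h.2.symm
      · exact h.1.symm
    · simp
  · rw [Finset.sum_eq_zero]
    · simp [hadj]
    · intro a _
      refine if_neg ?_
      rintro ⟨rfl, rfl⟩
      exact hadj a.adj.symm

/-- From `D D* = 1`, `R² = 1` and `D R D* = M` follows `U² D* = 2 U D* M - D*`, which is the
three-term recurrence of `T_n`. -/
lemma boundaryMatrix_mul_evolutionMatrix_pow (hd : G.IsRegularOfDegree d) (hd0 : 0 < d) (n : ℕ) :
    boundaryMatrix G * (evolutionMatrix G ^ n * (boundaryMatrix G)ᴴ) =
      (aeval ((1 / d : ℝ) • G.adjMatrix ℝ) (Chebyshev.T ℝ n)).map Complex.ofRealHom := by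
  set D := boundaryMatrix G with hD
  set R := shiftMatrix G with hR
  set U := evolutionMatrix G with hU
  set M : Matrix V V ℝ := (1 / d : ℝ) • G.adjMatrix ℝ with hM
  have hDD : D * Dᴴ = 1 := boundaryMatrix_mul_conjTranspose hd hd0
  have hP : D * (R * Dᴴ) = M.map Complex.ofRealHom := boundaryMatrix_mul_shiftMatrix_mul hd hd0
  have hRR : R * R = 1 := shiftMatrix_mul_self
  have hUd : U = R * ((2 : ℂ) • (Dᴴ * D) - 1) := rfl
  have hU1 : U * Dᴴ = R * Dᴴ := by
    rw [hUd, Matrix.mul_assoc, Matrix.sub_mul, Matrix.smul_mul, Matrix.mul_assoc Dᴴ, hDD,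
      Matrix.mul_one, Matrix.one_mul, two_smul, add_sub_cancel_right]
  have hU2 : U * (U * Dᴴ) = (2 : ℂ) • (U * Dᴴ * M.map Complex.ofRealHom) - Dᴴ := by
    rw [hU1, hUd, Matrix.mul_assoc, Matrix.sub_mul, Matrix.smul_mul, Matrix.mul_assoc Dᴴ, hP,
      Matrix.one_mul, Matrix.mul_sub, ← Matrix.mul_assoc R R, hRR, Matrix.one_mul,
      Matrix.mul_smul, ← Matrix.mul_assoc]
  have hrec (n : ℕ) : D * (U ^ (n + 2) * Dᴴ) =
      (2 : ℂ) • (D * (U ^ (n + 1) * Dᴴ) * M.map Complex.ofRealHom) - D * (U ^ n * Dᴴ) := by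
    rw [pow_add, pow_two, Matrix.mul_assoc, Matrix.mul_assoc U, hU2, pow_succ]
    simp only [Matrix.mul_sub, Matrix.mul_smul, Matrix.mul_assoc]
  induction n using Nat.twoStepInduction with
  | zero => simp [hDD]
  | one => simp [hU1, hP]
  | more n ih1 ih2 =>
    rw [hrec, ih1, ih2]
    push_cast
    rw [Chebyshev.T_add_two, mul_assoc, mul_comm X, two_mul, map_sub, map_add, map_mul, aeval_X]
    ext x y
    simp [two_smul, Matrix.map_apply, ← Matrix.map_mul]

lemma isSymm_aeval {A : Matrix V V ℝ} (hA : A.IsSymm) (f : ℝ[X]) : (aeval A f).IsSymm := by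
  induction f using Polynomial.induction_on' with
  | add p q hp hq => rw [map_add]; exact hp.add hq
  | monomial n a =>
    rw [aeval_monomial, ← Algebra.smul_def]
    exact (hA.pow n).smul a

/-- Applying the boundary matrix to the transfer equation shows that column `x` of the real
symmetric matrix `T_τ(A/d)` is `γ e_y`, of norm 1. The composition presents it as a polynomial in
`A` itself, as walk-regularity requires. -/
lemma exists_aeval_chebyshev_mul_self_diag_eq_one (hd : G.IsRegularOfDegree d) (hd0 : 0 < d)
    (hpst : AdmitsPerfectStateTransfer G) :
    ∃ τ : ℕ, 1 ≤ τ ∧ ∃ x : V,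
      aeval (G.adjMatrix ℝ) (((Chebyshev.T ℝ τ).comp (C (1 / d : ℝ) * X)) ^ 2) x x = 1 := by
  obtain ⟨Φ, Ψ, ⟨-, x, rfl⟩, ⟨-, y, rfl⟩, τ, -, -, -, hτ, γ, hγ, h⟩ := hpst
  refine ⟨τ, hτ, x, ?_⟩
  set f : ℝ[X] := (Chebyshev.T ℝ τ).comp (C (1 / d : ℝ) * X) with hf
  have hN : aeval (G.adjMatrix ℝ) f = aeval ((1 / d : ℝ) • G.adjMatrix ℝ) (Chebyshev.T ℝ τ) := by
    rw [hf, aeval_comp, map_mul, aeval_C, aeval_X, ← Algebra.smul_def]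
  set N := aeval (G.adjMatrix ℝ) f with hNdef
  have h1 := congrArg (boundaryMatrix G *ᵥ ·) h
  simp only [mulVec_smul, mulVec_mulVec] at h1
  rw [boundaryMatrix_mul_evolutionMatrix_pow hd hd0, ← hN,
    boundaryMatrix_mul_conjTranspose hd hd0, one_mulVec] at h1
  have h2 (z : V) : (N z x : ℂ) = γ * (Pi.single y 1 : V → ℂ) z := by
    simpa using congrFun h1 z
  have hz (z : V) (hzy : z ≠ y) : N z x = 0 := by
    have := h2 z
    rw [Pi.single_eq_of_ne hzy, mul_zero] at this
    exact_mod_cast this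
  have hy : N y x * N y x = 1 := by
    have := congrArg norm (h2 y)
    rw [Pi.single_eq_same, mul_one, hγ, Complex.norm_real, Real.norm_eq_abs] at this
    rw [← abs_mul_abs_self, this, one_mul]
  have hsymm : N.IsSymm := isSymm_aeval G.isSymm_adjMatrix f
  rw [map_pow, pow_two, Matrix.mul_apply, Finset.sum_eq_single y]
  · rw [← hNdef, hsymm.apply, hy]
  · intro z _ hzy
    rw [← hNdef, hz z hzy, mul_zero]
  · simp

/-- If `G` is a walk-regular graph with perfect state transfer at time `τ`, then `T_τ` takes the
values `±1` at the normalized eigenvalues. -/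
lemma exists_abs_eval_chebyshev_eq_one (hd : G.IsRegularOfDegree d) (hd0 : 0 < d)
    (hdiag : ∀ (f : ℝ[X]) (u w : V), aeval (G.adjMatrix ℝ) f u u = aeval (G.adjMatrix ℝ) f w w)
    (hpst : AdmitsPerfectStateTransfer G) :
    ∃ τ : ℕ, 1 ≤ τ ∧ ∀ r ∈ graphSpectrum G, |(Chebyshev.T ℝ τ).eval (r / d)| = 1 := by
  obtain ⟨τ, hτ, x, hx⟩ := exists_aeval_chebyshev_mul_self_diag_eq_one hd hd0 hpst
  refine ⟨τ, hτ, ?_⟩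
  set f : ℝ[X] := (Chebyshev.T ℝ τ).comp (C (1 / d : ℝ) * X) with hf
  have hA := SimpleGraph.isHermitian_adjMatrix_real (G := G)
  have hroots := hA.roots_charpoly_eq_eigenvalues
  have heval (r : ℝ) : f.eval r = (Chebyshev.T ℝ τ).eval (r / d) := by
    rw [hf, eval_comp, eval_mul, eval_C, eval_X, one_div, inv_mul_eq_div]
  have hle (i : V) : 0 ≤ 1 - f.eval (hA.eigenvalues i) ^ 2 := by
    have hi : |hA.eigenvalues i| ≤ d := hd.abs_le_of_mem_roots (by rw [hroots]; simp)
    have h1 : |hA.eigenvalues i / d| ≤ 1 := by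
      rw [abs_div, Nat.abs_cast]
      exact div_le_one_of_le₀ hi (Nat.cast_nonneg d)
    rw [heval, sub_nonneg, sq_le_one_iff_abs_le_one]
    exact Chebyshev.abs_eval_T_real_le_one τ h1
  -- Walk-regularity spreads the diagonal entry 1 to all vertices, so `f(A)²` has trace `|V|`.
  have hsum : ∑ i, (1 - f.eval (hA.eigenvalues i) ^ 2) = 0 := by
    have htr := hA.trace_aeval (f ^ 2)
    rw [hroots, Matrix.trace] at htr
    simp only [diag_apply, hdiag (f ^ 2) _ x, hx] at htr
    rw [Finset.sum_sub_distrib, htr, Multiset.map_map, Finset.sum_map_val]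
    simp
  intro r hr
  rw [graphSpectrum, hroots, Multiset.mem_map] at hr
  obtain ⟨i, -, rfl⟩ := hr
  have h1 := (Finset.sum_eq_zero_iff_of_nonneg fun i _ => hle i).1 hsum i (Finset.mem_univ i)
  rw [heval] at h1
  rw [← sq_eq_sq₀ (abs_nonneg _) zero_le_one, sq_abs, one_pow]
  exact (sub_eq_zero.1 h1).symm

/-- The points of `[-1, 1]` where `T_τ = ±1` are the `cos (kπ/τ)`, and `2 cos (kπ/τ)` is a sum of
two roots of unity. -/
lemma isIntegral_two_mul_of_abs_eval_chebyshev_eq_one {τ : ℕ} (hτ : 1 ≤ τ) {x : ℝ}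
    (h : |(Chebyshev.T ℝ τ).eval x| = 1) : IsIntegral ℤ (2 * x) := by
  obtain ⟨k, -, rfl⟩ := (Chebyshev.abs_eval_T_real_eq_one_iff (by omega) x).1 h
  have := Real.isIntegral_two_mul_cos_rat_mul_pi (k / τ)
  push_cast at this
  rwa [div_mul_eq_mul_div] at this

end GroverWalk

/-! ### Spectral moments and the final assembly -/

lemma exists_int_eq_of_isIntegral {x : ℝ} {q : ℚ} (hq : x = q) (hx : IsIntegral ℤ x) :
    ∃ z : ℤ, x = z := by
  have h : IsIntegral ℤ q := by
    rw [← isIntegral_algebraMap_iff (B := ℝ) (algebraMap ℚ ℝ).injective]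
    rw [hq] at hx
    exact hx
  obtain ⟨z, rfl⟩ := IsIntegrallyClosed.isIntegral_iff.1 h
  exact ⟨z, by simpa using hq⟩

/-- A multiset with four distinct members is determined by their multiplicities. -/
lemma Multiset.eq_of_toFinset_eq_four {s : Multiset ℝ} {k x y z : ℝ} (hxk : x < k) (hyx : y < x)
    (hzy : z < y) (h : s.toFinset = {k, x, y, z}) (hk : s.count k = 1) :
    ∃ l m n : ℕ, 1 ≤ l ∧ 1 ≤ m ∧ 1 ≤ n ∧
      s = {k} + Multiset.replicate l x + Multiset.replicate m y + Multiset.replicate n z := by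
  have hzx := hzy.trans hyx
  have hpos (a : ℝ) (ha : a ∈ s.toFinset) : 1 ≤ s.count a :=
    Multiset.one_le_count_iff_mem.2 (Multiset.mem_toFinset.1 ha)
  refine ⟨s.count x, s.count y, s.count z, hpos _ (by simp [h]), hpos _ (by simp [h]),
    hpos _ (by simp [h]), ?_⟩
  conv_lhs => rw [← Multiset.toFinset_sum_count_nsmul_eq s]
  rw [h, Finset.sum_insert (by simp; exact ⟨hxk.ne', (hyx.trans hxk).ne', (hzx.trans hxk).ne'⟩),
    Finset.sum_insert (by simp; exact ⟨hyx.ne', hzx.ne'⟩),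
    Finset.sum_insert (by simpa using hzy.ne'), Finset.sum_singleton, hk]
  simp only [one_smul, Multiset.nsmul_singleton, add_assoc]

namespace GroverWalk

open Matrix Polynomial

variable {V : Type*} [Fintype V] [DecidableEq V] {G : SimpleGraph V} [DecidableRel G.Adj] {d : ℕ}

lemma card_graphSpectrum : Multiset.card (graphSpectrum G) = Fintype.card V := by
  rw [graphSpectrum, SimpleGraph.isHermitian_adjMatrix_real.roots_charpoly_eq_eigenvalues]
  simp

lemma sum_graphSpectrum : (graphSpectrum G).sum = 0 := by
  have h := SimpleGraph.isHermitian_adjMatrix_real.trace_aeval (A := G.adjMatrix ℝ) X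
  simpa [graphSpectrum] using h.symm

lemma sum_sq_graphSpectrum (hd : G.IsRegularOfDegree d) :
    ((graphSpectrum G).map fun r : ℝ => r ^ 2).sum = Fintype.card V * d := by
  have h := SimpleGraph.isHermitian_adjMatrix_real.trace_aeval (A := G.adjMatrix ℝ) (X ^ 2)
  have hdiag (v : V) : (G.adjMatrix ℝ ^ 2) v v = d := by
    rw [pow_two, SimpleGraph.adjMatrix_mul_self_apply_self, hd v]
  simpa [graphSpectrum, Matrix.trace, hdiag] using h.symm

lemma map_charpoly_adjMatrix_rat :
    (G.adjMatrix ℚ).charpoly.map (algebraMap ℚ ℝ) = (G.adjMatrix ℝ).charpoly := by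
  rw [← Matrix.charpoly_map]
  congr 1
  ext x y
  simp [SimpleGraph.adjMatrix_apply, apply_ite]

end GroverWalk

open Polynomial in
theorem mainTheorem4 {V : Type*} [Fintype V] [DecidableEq V]
    (G : SimpleGraph V) [DecidableRel G.Adj]
    (hG : GroverWalk.IsGenuineStronglyWalkRegular G)
    (k θ₁ θ₂ θ₃ : ℝ) (h₁ : θ₁ < k) (h₂ : θ₂ < θ₁) (h₃ : θ₃ < θ₂)
    (hspec : GroverWalk.distinctEigenvalues G = {k, θ₁, θ₂, θ₃})
    (hpst : GroverWalk.AdmitsPerfectStateTransfer G) :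
    (∃ d : ℕ, k = d ∧ G.IsRegularOfDegree d) ∧
    (θ₁ = k / 2 ∧ θ₂ = 0 ∧ θ₃ = -(k / 2)) ∧
    ∃ α β γ : ℕ, 1 ≤ α ∧ 1 ≤ β ∧ 1 ≤ γ ∧
      GroverWalk.graphSpectrum G =
        {k} + Multiset.replicate α (k / 2) + Multiset.replicate β 0 +
          Multiset.replicate γ (-(k / 2)) := by
  obtain ⟨hconn, ⟨n, hn, a, b, c, hA⟩, -⟩ := hG
  have := hconn.nonempty
  have hc := GroverWalk.ne_zero_of_pow_eq hn h₁ h₂ h₃ hspec hA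
  obtain ⟨d, hd⟩ := GroverWalk.isRegularOfDegree_of_pow_eq hc hA
  have hmem (r : ℝ) : r ∈ GroverWalk.graphSpectrum G ↔ r = k ∨ r = θ₁ ∨ r = θ₂ ∨ r = θ₃ := by
    rw [← Multiset.mem_toFinset, ← GroverWalk.distinctEigenvalues, hspec]
    simp
  have habs (r : ℝ) (hr : r ∈ GroverWalk.graphSpectrum G) : |r| ≤ d := hd.abs_le_of_mem_roots hr
  obtain rfl : k = d := by
    have hk := (le_abs_self k).trans (habs k ((hmem k).2 (by simp)))
    rcases (hmem d).1 hd.mem_roots with h | h | h | h <;> linarith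
  have hm1 : θ₁ ∈ GroverWalk.graphSpectrum G := (hmem _).2 (by simp)
  have hm2 : θ₂ ∈ GroverWalk.graphSpectrum G := (hmem _).2 (by simp)
  have hm3 : θ₃ ∈ GroverWalk.graphSpectrum G := (hmem _).2 (by simp)
  have hd3 := neg_le_of_abs_le (habs _ hm3)
  have hdpos : (0 : ℝ) < d := by linarith
  have hd0 : 0 < d := by exact_mod_cast hdpos
  obtain ⟨α, β, γ, hα, hβ, hγ, hmult⟩ := Multiset.eq_of_toFinset_eq_four h₁ h₂ h₃ hspec
    (GroverWalk.count_graphSpectrum_degree hd hA hc)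
  have hcard := GroverWalk.card_graphSpectrum (G := G)
  have hsum := GroverWalk.sum_graphSpectrum (G := G)
  have hsq := GroverWalk.sum_sq_graphSpectrum hd
  rw [← hcard, hmult] at hsq
  rw [hmult] at hsum
  simp at hsq hsum
  -- Rescaling by `2/d` turns the trinomial into another one.
  have hpow (r : ℝ) (hr : r ∈ GroverWalk.graphSpectrum G) (hrd : r ≠ d) :
      (2 * (r / d)) ^ n = ((2 / d) ^ n * b / (2 / d)) * (2 * (r / d)) + (2 / d) ^ n * a := by
    have h := GroverWalk.eval_trinomial_eq_zero hd hA hr hrd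
    simp at h
    rw [show 2 * (r / d) = 2 / d * r by ring, mul_pow, show r ^ n = b * r + a by linarith]
    field_simp
  obtain ⟨s, t, p, hs, ht, hp⟩ := exists_rat_elementary_symmetric (k := d)
    (G.adjMatrix ℚ).charpoly_monic.ne_zero
    (by
      rw [GroverWalk.map_charpoly_adjMatrix_rat]
      exact SimpleGraph.isHermitian_adjMatrix_real.splits_charpoly)
    (by simpa using h₁) h₂ h₃ (by
      rw [GroverWalk.map_charpoly_adjMatrix_rat]
      exact hspec)
  obtain ⟨τ, hτ, hT⟩ := GroverWalk.exists_abs_eval_chebyshev_eq_one hd hd0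
    (fun f u w => GroverWalk.aeval_adjMatrix_diag_eq hd hA hc (fun r hr => (hmem r).1 hr) f u w) hpst
  have hint (r : ℝ) (hr : r ∈ GroverWalk.graphSpectrum G) : IsIntegral ℤ (2 * (r / d)) :=
    GroverWalk.isIntegral_two_mul_of_abs_eval_chebyshev_eq_one hτ (hT r hr)
  have hi1 := hint _ hm1
  have hi2 := hint _ hm2
  have hi3 := hint _ hm3
  have hp1 := hpow _ hm1 h₁.ne
  have hp2 := hpow _ hm2 (h₂.trans h₁).ne
  have hp3 := hpow _ hm3 (h₃.trans (h₂.trans h₁)).ne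
  have e1 : θ₁ = d / 2 * (2 * (θ₁ / d)) := by field_simp
  have e2 : θ₂ = d / 2 * (2 * (θ₂ / d)) := by field_simp
  have e3 : θ₃ = d / 2 * (2 * (θ₃ / d)) := by field_simp
  generalize 2 * (θ₁ / (d : ℝ)) = x at hi1 hp1 e1
  generalize 2 * (θ₂ / (d : ℝ)) = y at hi2 hp2 e2
  generalize 2 * (θ₃ / (d : ℝ)) = z at hi3 hp3 e3
  subst e1 e2 e3
  have hd2 : (0 : ℝ) < d / 2 := by linarith
  have hyx : y < x := lt_of_mul_lt_mul_left h₂ hd2.le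
  have hzy : z < y := lt_of_mul_lt_mul_left h₃ hd2.le
  have hx2 : x < 2 := by
    refine lt_of_mul_lt_mul_left (a := (d / 2 : ℝ)) ?_ hd2.le
    linarith
  have hz2 : -2 ≤ z := by
    refine le_of_mul_le_mul_left (a := (d / 2 : ℝ)) ?_ hd2
    linarith
  obtain ⟨S, hS⟩ := exists_int_eq_of_isIntegral (x := x + y + z) (q := 2 / d * s)
    (by push_cast; rw [← hs]; field_simp) ((hi1.add hi2).add hi3)
  obtain ⟨T, hT⟩ := exists_int_eq_of_isIntegral (x := x * y + y * z + z * x)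
    (q := (2 / d) ^ 2 * t) (by push_cast; rw [← ht]; field_simp)
    (((hi1.mul hi2).add (hi2.mul hi3)).add (hi3.mul hi1))
  obtain ⟨P, hP⟩ := exists_int_eq_of_isIntegral (x := x * y * z)
    (q := (2 / d) ^ 3 * p) (by push_cast; rw [← hp]; field_simp)
    ((hi1.mul hi2).mul hi3)
  have hzero := sum_eq_zero_of_pow_eq_affine hn hyx hzy hx2.le hz2 hp1 hp2 hp3 hS hT hP
  -- The two moment conditions are `tr A = 0` and `tr A² = |V| d` in the rescaled eigenvalues.
  obtain ⟨rfl, rfl, rfl⟩ := eq_one_zero_neg_one (d := d) (l := α) (m := β) (n := γ)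
    hyx hzy hx2 hz2 hzero hT hP hα
    (by
      refine mul_left_cancel₀ hd2.ne' ?_
      linear_combination hsum)
    (by
      refine mul_left_cancel₀ hdpos.ne' ?_
      linear_combination 4 * hsq)
  refine ⟨⟨d, rfl, hd⟩, ⟨by ring, by ring, by ring⟩, α, β, γ, hα, hβ, hγ, ?_⟩
  rw [hmult]
  simp
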